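/- Let $\Bbbk$ be a field, let $n,c,s$ be positive integers with $1\le c\le\min\{n,s\}$ and $s\ge n+1$, and let $F_1,\ldots,F_s$ be forms (homogeneous polynomials of any degrees) in $R=\Bbbk[x_0,\ldots,x_n]$ such that every subset of $\mathcal F=\{F_1,\ldots,F_s\}$ of cardinality $c+1$ is a regular sequence in $R$. Put $$I_{c,\mathcal F}=\bigcap_{1\le i_1<\cdots<i_c\le s}\langle F_{i_1},\ldots,F_{i_c}\rangle .$$ For an ideal $I\subseteq R$ and a positive integer $m$, let $I^{(m)}=\bigcap_{P\in\operatorname{Ass}(R/I)}(I^mR_P\cap R)$ be the $m$-th symbolic power of $I$, and let $\operatorname{sdefect}(I,m)$ be the minimal number of generators of the $R$-module $I^{(m)}/I^m$. Then, for every positive integer $m$, $$\operatorname{sdefect}(I_{c,\mathcal F},m)=1\quad\text{if and only if}\quad c=m=2 .$$ -/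

import Mathlib

noncomputable section

namespace StarConfig

/-- The `m`-th symbolic power `I^(m) = ⋂_{P ∈ Ass(R/I)} (I^m R_P ∩ R)` of an ideal `I`. -/
def symbolicPower {R : Type*} [CommRing R] (I : Ideal R) (m : ℕ) : Ideal R :=
  ⨅ (P : Ideal R) (hP : P ∈ associatedPrimes R (R ⧸ I)),
    haveI : P.IsPrime := hP.isPrime
    ((I ^ m).map (algebraMap R (Localization.AtPrime P))).comap
      (algebraMap R (Localization.AtPrime P))

/-- The `m`-th symbolic defect of `I`: the minimal number of generators of the `R`-module
`I^(m) / I^m`. -/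
def sdefect {R : Type*} [CommRing R] (I : Ideal R) (m : ℕ) : ℕ :=
  (⊤ : Submodule R
    (symbolicPower I m ⧸ Submodule.submoduleOf (I ^ m) (symbolicPower I m))).spanFinrank

/-- `F_1, …, F_s` are forms in `𝕜[x_0, …, x_n]` that define a star configuration of
codimension `c`: all subfamilies of size `c + 1` are regular sequences (each listed in increasing
order of the indices; for forms the order is immaterial). -/
structure IsStarConfiguration {𝕜 : Type*} [Field 𝕜] (n c s : ℕ)
    (F : Fin s → MvPolynomial (Fin (n + 1)) 𝕜) : Prop where
  one_le_c : 1 ≤ c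
  c_le : c ≤ min n s
  isHomogeneous : ∀ i, ∃ d : ℕ, (F i).IsHomogeneous d
  isRegular : ∀ A : Finset (Fin s), A.card = c + 1 →
    RingTheory.Sequence.IsRegular (MvPolynomial (Fin (n + 1)) 𝕜)
      ((A.sort (· ≤ ·)).map F)

/-- The ideal `I_{c,F} = ⋂_{i_1 < ⋯ < i_c} ⟨F_{i_1}, …, F_{i_c}⟩`. -/
def starIdeal {R : Type*} [CommRing R] {s : ℕ} (c : ℕ) (F : Fin s → R) : Ideal R :=
  ⨅ (A : Finset (Fin s)) (_ : A.card = c), Ideal.span (F '' (A : Set (Fin s)))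

end StarConfig

end

namespace StarConfig

/-! Forms of positive degree in a regular sequence may be permuted, so each `F j` is a
nonzerodivisor modulo any at most `c` others. Hence I^(m) is governed by the m-th powers of the
ideals (F_i : i ∈ C) with |C| = c. For m = 1, and for c = 1, where I is principal, I^(m) = I^m. For
c = m = 2, I^(2) = (∏ F_i) + I^2 (`symbolicPower_starIdeal_two_le`).

For c, m ≥ 2, fix a set A of s + 2 - c indices and i ∈ A, kill the F_j with j ∉ A, and put x = F_i,
y = ∏_{j ∈ A∖i} F_j. Then I^(m) maps into (x, y)^m, and I into 𝔪x + (y), where 𝔪 is generated by the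
variables. So x y^(m-1), which lifts to an element of I^(m), avoids an ideal containing 𝔪 I^(m) +
I^m (`mem_of_mul_distinguished_mem_testIdeal`); the defect is therefore nonzero. Varying i if m ≥ 3,
or A if m = 2 and c ≥ 3, gives two such elements independent modulo 𝔪 I^(m) + I^m, and the
Nakayama-type argument of `not_symbolicPower_le_span_sup_pow` shows that I^(m)/I^m is not cyclic. -/

/-- `s` is a nonzerodivisor modulo the ideal `I`. -/
def IsRegularMod {R : Type*} [CommRing R] (I : Ideal R) (s : R) : Prop :=
  ∀ z, s * z ∈ I → z ∈ I

/-! ### Powers of ideals generated by a regular sequence of length two. -/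

section TwoGenerated

variable {R : Type*} [CommRing R]

open Ideal

theorem IsRegularMod.one (I : Ideal R) : IsRegularMod I 1 := fun z hz => by simpa using hz

theorem IsRegularMod.mul {I : Ideal R} {s t : R} (hs : IsRegularMod I s)
    (ht : IsRegularMod I t) : IsRegularMod I (s * t) :=
  fun z hz => ht z (hs _ (by rwa [← mul_assoc]))

theorem IsRegularMod.pow {I : Ideal R} {s : R} (hs : IsRegularMod I s) (k : ℕ) :
    IsRegularMod I (s ^ k) := by
  induction k with
  | zero => simpa using IsRegularMod.one I
  | succ k ih => rw [pow_succ]; exact ih.mul hs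

theorem IsRegularMod.prod {ι : Type*} {I : Ideal R} (T : Finset ι) {f : ι → R}
    (h : ∀ i ∈ T, IsRegularMod I (f i)) : IsRegularMod I (∏ i ∈ T, f i) :=
  Finset.prod_induction f (IsRegularMod I) (fun _ _ => IsRegularMod.mul) (IsRegularMod.one I) h

theorem IsRegularMod.cancel {x : R} (hx : IsRegularMod (⊥ : Ideal R) x) {a b : R}
    (h : x * a = x * b) : a = b :=
  sub_eq_zero.1 <| hx _ <| by simp [mul_sub, h]

/-- Elements of `(x, y)^(m+1)` are combinations of `y^(m+1)` and elements of `x (x, y)^m`. -/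
theorem mem_span_pair_pow_succ {x y f : R} {m : ℕ} :
    f ∈ span {x, y} ^ (m + 1) ↔ ∃ e, ∃ h ∈ span {x, y} ^ m, f = e * y ^ (m + 1) + x * h := by
  constructor
  · intro hf
    induction m generalizing f with
    | zero =>
      rw [zero_add, pow_one, mem_span_pair] at hf
      obtain ⟨a, b, rfl⟩ := hf
      exact ⟨b, a, by simp, by ring⟩
    | succ m ih =>
      rw [pow_succ] at hf
      refine Submodule.mul_induction_on hf ?_ ?_
      · intro p hp q hq
        obtain ⟨e, h, hh, rfl⟩ := ih hp
        obtain ⟨a, b, rfl⟩ := mem_span_pair.1 hq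
        refine ⟨e * b, a * (e * y ^ (m + 1) + x * h) + b * y * h, ?_, by ring⟩
        refine add_mem (Ideal.mul_mem_left _ _ hp) ?_
        rw [pow_succ']
        exact Ideal.mul_mem_mul (Ideal.mul_mem_left _ _ (subset_span (by simp))) hh
      · rintro _ _ ⟨e, h, hh, rfl⟩ ⟨e', h', hh', rfl⟩
        exact ⟨e + e', h + h', add_mem hh hh', by ring⟩
  · rintro ⟨e, h, hh, rfl⟩
    refine add_mem (Ideal.mul_mem_left _ _ (Ideal.pow_mem_pow (subset_span (by simp)) _)) ?_
    rw [pow_succ']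
    exact Ideal.mul_mem_mul (subset_span (by simp)) hh

theorem mul_pow_mem_span_pair_pow {x y : R} (a : R) (m : ℕ) : a * y ^ m ∈ span {x, y} ^ m :=
  Ideal.mul_mem_left _ _ (Ideal.pow_mem_pow (subset_span (by simp)) _)

/-- Expand x g = e y^(m+1) + x h. Since y is regular modulo x, x divides e and can be cancelled. -/
theorem of_mul_mem_span_pair_pow_succ {x y g : R} {m : ℕ} (hx : IsRegularMod ⊥ x)
    (hy : IsRegularMod (span {x}) y) (h : x * g ∈ span {x, y} ^ (m + 1)) :
    g ∈ span {x, y} ^ m := by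
  obtain ⟨e, h, hh, heq⟩ := mem_span_pair_pow_succ.1 h
  obtain ⟨a, rfl⟩ := mem_span_singleton'.1 <| hy.pow (m + 1) e <|
    mem_span_singleton'.2 ⟨g - h, by linear_combination heq⟩
  have : g = a * y * y ^ m + h := hx.cancel (by rw [heq]; ring)
  rw [this]
  exact add_mem (mul_pow_mem_span_pair_pow _ _) hh

/-- If `x, y` is a regular sequence, a nonzerodivisor modulo `(x, y)` is one modulo `(x, y)^m`. -/
theorem IsRegularMod.span_pair_pow {x y s : R} (hx : IsRegularMod ⊥ x)
    (hy : IsRegularMod (span {x}) y) (hs : IsRegularMod (span {x, y}) s) (m : ℕ) :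
    IsRegularMod (span {x, y} ^ m) s := by
  induction m with
  | zero => intro z _; simp
  | succ m ih =>
    intro f hf
    have hfm : f ∈ span {x, y} ^ m := ih f (Ideal.pow_le_pow_right m.le_succ hf)
    obtain _ | m := m
    · rw [zero_add, pow_one] at hf ⊢
      exact hs f hf
    obtain ⟨e, h, hh, rfl⟩ := mem_span_pair_pow_succ.1 hfm
    obtain ⟨e', h', hh', heq⟩ := mem_span_pair_pow_succ.1 hf
    -- Comparing both expansions modulo x and cancelling y^(m+1) gives s e ≡ e' y, so e ∈ (x, y) and
    -- the term e y^(m+1) already lies one power deeper.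
    have h1 : s * e ∈ span {x, y} := by
      have : s * e - e' * y ∈ span {x} := hy.pow (m + 1) _ <|
        mem_span_singleton'.2 ⟨h' - s * h, by linear_combination (-1 : R) * heq⟩
      have h2 := add_mem (span_mono (by simp) this : s * e - e' * y ∈ span {x, y})
        (Ideal.mul_mem_left _ e' (subset_span (by simp) : y ∈ span {x, y}))
      simpa using h2
    have h2 : e * y ^ (m + 1) ∈ span {x, y} ^ (m + 1 + 1) := by
      rw [pow_succ']
      exact Ideal.mul_mem_mul (hs e h1) (Ideal.pow_mem_pow (subset_span (by simp)) _)
    refine add_mem h2 (mem_span_pair_pow_succ.2 ⟨0, h, ih h ?_, by simp⟩)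
    refine of_mul_mem_span_pair_pow_succ hx hy ?_
    have h3 := sub_mem hf (Ideal.mul_mem_left _ s h2)
    convert h3 using 1
    ring

/-- One factor z is peeled off at a time: e = p x + q z by regularity modulo (x, z), and cancelling
z modulo x leaves y q ∈ (x, z^k). -/
theorem IsRegularMod.span_pair_pow_right {x y z : R} (hz : IsRegularMod (span {x}) z)
    (hy : IsRegularMod (span {x, z}) y) (k : ℕ) : IsRegularMod (span {x, z ^ k}) y := by
  induction k with
  | zero => intro e _; exact mem_span_pair.2 ⟨0, e, by simp⟩
  | succ k ih =>
    intro e he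
    have h1 : y * e ∈ span {x, z} := by
      obtain ⟨a, b, h⟩ := mem_span_pair.1 he
      exact mem_span_pair.2 ⟨a, b * z ^ k, by rw [← h]; ring⟩
    obtain ⟨p, q, rfl⟩ := mem_span_pair.1 (hy e h1)
    obtain ⟨a, b, h⟩ := mem_span_pair.1 he
    have h2 : y * q - b * z ^ k ∈ span {x} := hz _ <|
      mem_span_singleton'.2 ⟨a - y * p, by linear_combination h⟩
    obtain ⟨r, hr⟩ := mem_span_singleton'.1 h2
    obtain ⟨a', b', h'⟩ := mem_span_pair.1 <| ih q <|
      mem_span_pair.2 ⟨r, b, by linear_combination hr⟩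
    exact mem_span_pair.2 ⟨p + a' * z, b', by linear_combination z * h'⟩

/-- The coefficient e of y^(m+1) must lie in (x, z^(m+1)), which turns the leading term into a
multiple of (y z)^(m+1) plus a multiple of x. The cofactor of x lies in both m-th powers, so
induction applies. -/
theorem span_pair_pow_inf_le {x y z : R} (hx : IsRegularMod ⊥ x)
    (hz : IsRegularMod (span {x}) z)
    (hyz : IsRegularMod (span {x, z}) y) (m : ℕ) :
    span {x, y} ^ m ⊓ span {x, z} ^ m ≤ span {x, y * z} ^ m := by
  induction m with
  | zero => simp
  | succ m ih =>
    rintro f ⟨hf, hf'⟩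
    obtain ⟨e, h, hh, rfl⟩ := mem_span_pair_pow_succ.1 hf
    obtain ⟨e', h', hh', heq⟩ := mem_span_pair_pow_succ.1 hf'
    have he : e ∈ span {x, z ^ (m + 1)} := ((hz.span_pair_pow_right hyz _).pow (m + 1)) e <|
      mem_span_pair.2 ⟨h' - h, e', by linear_combination (-1 : R) * heq⟩
    obtain ⟨p, b, rfl⟩ := mem_span_pair.1 he
    refine mem_span_pair_pow_succ.2 ⟨b, p * y ^ (m + 1) + h, ih ⟨?_, ?_⟩, by ring⟩
    · exact add_mem (Ideal.pow_le_pow_right m.le_succ (mul_pow_mem_span_pair_pow _ _)) hh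
    · refine of_mul_mem_span_pair_pow_succ hx hz ?_
      have h3 := sub_mem hf' (mul_pow_mem_span_pair_pow (x := x) (y := z)
        (b * y ^ (m + 1)) (m + 1))
      convert h3 using 1
      ring

/-- Intersecting powers of the ideals `(x, F j)` amounts to multiplying the `F j`. -/
theorem mem_span_pair_prod_pow {ι : Type*} [DecidableEq ι] {x : R} {F : ι → R} {T : Finset ι}
    (hx : IsRegularMod ⊥ x) (h1 : ∀ j ∈ T, IsRegularMod (span {x}) (F j))
    (h2 : ∀ j ∈ T, ∀ k ∈ T, j ≠ k → IsRegularMod (span {x, F k}) (F j)) {m : ℕ} {f : R}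
    (hf : ∀ j ∈ T, f ∈ span {x, F j} ^ m) : f ∈ span {x, ∏ j ∈ T, F j} ^ m := by
  induction T using Finset.induction_on with
  | empty =>
    have : span {x, (1 : R)} = ⊤ := (eq_top_iff_one _).2 (subset_span (by simp))
    rw [Finset.prod_empty, this, Ideal.top_pow]
    trivial
  | insert k T hk ih =>
    rw [Finset.prod_insert hk, mul_comm]
    refine span_pair_pow_inf_le hx
      (h1 k (Finset.mem_insert_self _ _)) (IsRegularMod.prod T fun j hj =>
        h2 j (Finset.mem_insert_of_mem hj) k (Finset.mem_insert_self _ _) ?_) m ⟨ih ?_ ?_ ?_, ?_⟩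
    · rintro rfl; exact hk hj
    · exact fun j hj => h1 j (Finset.mem_insert_of_mem hj)
    · exact fun j hj l hl =>
        h2 j (Finset.mem_insert_of_mem hj) l (Finset.mem_insert_of_mem hl)
    · exact fun j hj => hf j (Finset.mem_insert_of_mem hj)
    · exact hf k (Finset.mem_insert_self _ _)

/-- The ideal of those combinations of `y^m`, `x y^(m-1)` and `x^2` in which the coefficient of
`x y^(m-1)` lies in `𝔪`. -/
def leadingIdeal (𝔪 : Ideal R) (x y : R) (m : ℕ) : Ideal R :=
  span {y ^ m} ⊔ (span {x * y ^ (m - 1)} * 𝔪 ⊔ span {x ^ 2})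

theorem mem_leadingIdeal {𝔪 : Ideal R} {x y f : R} {m : ℕ} :
    f ∈ leadingIdeal 𝔪 x y m ↔
      ∃ a, ∃ b ∈ 𝔪, ∃ c, f = a * y ^ m + (x * y ^ (m - 1) * b + c * x ^ 2) := by
  simp only [leadingIdeal, Submodule.mem_sup, mem_span_singleton', mem_span_singleton_mul]
  constructor
  · rintro ⟨_, ⟨a, rfl⟩, _, ⟨_, ⟨b, hb, rfl⟩, _, ⟨c, rfl⟩, rfl⟩, rfl⟩
    exact ⟨a, b, hb, c, rfl⟩
  · rintro ⟨a, b, hb, c, rfl⟩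
    exact ⟨_, ⟨a, rfl⟩, _, ⟨_, ⟨b, hb, rfl⟩, _, ⟨c, rfl⟩, rfl⟩, rfl⟩

theorem mul_span_pair_pow_le_leadingIdeal {𝔪 : Ideal R} {x y : R} {m : ℕ} :
    𝔪 * span {x, y} ^ (m + 2) ≤ leadingIdeal 𝔪 x y (m + 2) := by
  rw [Ideal.mul_le]
  intro r hr f hf
  obtain ⟨e, h, hh, rfl⟩ := mem_span_pair_pow_succ.1 hf
  obtain ⟨e', h', hh', rfl⟩ := mem_span_pair_pow_succ.1 hh
  exact mem_leadingIdeal.2 ⟨r * e, r * e', Ideal.mul_mem_right _ _ hr, r * h', by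
    simp only [Nat.add_succ_sub_one]; ring⟩

/-- In a product of factors a x + b y, each term of the coefficient of x y^(m-1) contains exactly
one of the a's, hence lies in `𝔪`. -/
theorem pow_le_leadingIdeal {𝔪 I : Ideal R} {x y : R}
    (hI : ∀ f ∈ I, ∃ a ∈ 𝔪, ∃ b, f = a * x + b * y) {m : ℕ} (hm : 1 ≤ m) :
    I ^ m ≤ leadingIdeal 𝔪 x y m := by
  induction m, hm using Nat.le_induction with
  | base =>
    intro f hf
    rw [pow_one] at hf
    obtain ⟨a, ha, b, rfl⟩ := hI f hf
    exact mem_leadingIdeal.2 ⟨b, a, ha, 0, by simp; ring⟩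
  | succ m hm ih =>
    rw [pow_succ, Ideal.mul_le]
    intro p hp q hq
    obtain ⟨m, rfl⟩ := Nat.exists_eq_add_of_le' hm
    obtain ⟨a, b, hb, c, rfl⟩ := mem_leadingIdeal.1 (ih hp)
    obtain ⟨d, hd, e, rfl⟩ := hI q hq
    refine mem_leadingIdeal.2 ⟨a * e, a * d + b * e, add_mem (Ideal.mul_mem_left _ _ hd)
      (Ideal.mul_mem_right _ _ hb), y ^ m * b * d + c * (d * x + e * y), ?_⟩
    simp only [Nat.add_sub_cancel]
    ring

/-- Relations between y^m, x y^(m-1) and x^2 have middle coefficient in (x, y): reduce modulo x,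
cancel x, then cancel a power of y modulo x. -/
theorem mem_sup_span_pair_of_mul_mem_leadingIdeal {𝔪 : Ideal R} {x y α : R} {m : ℕ}
    (hx : IsRegularMod ⊥ x) (hy : IsRegularMod (span {x}) y) (hm : 1 ≤ m)
    (h : α * (x * y ^ (m - 1)) ∈ leadingIdeal 𝔪 x y m) : α ∈ 𝔪 ⊔ span {x, y} := by
  obtain ⟨m, rfl⟩ := Nat.exists_eq_add_of_le' hm
  obtain ⟨q, μ, hμ, p, heq⟩ := mem_leadingIdeal.1 h
  simp only [Nat.add_sub_cancel] at heq
  obtain ⟨q, rfl⟩ := mem_span_singleton'.1 <| hy.pow (m + 1) q <| mem_span_singleton'.2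
    ⟨α * y ^ m - y ^ m * μ - p * x, by linear_combination heq⟩
  have h1 : (α - μ) * y ^ m = q * y ^ (m + 1) + p * x :=
    hx.cancel (by linear_combination heq)
  obtain ⟨r, hr⟩ := mem_span_singleton'.1 <| hy.pow m (α - μ - q * y) <|
    mem_span_singleton'.2 ⟨p, by linear_combination (-1 : R) * h1⟩
  exact Submodule.mem_sup.2 ⟨μ, hμ, α - μ, mem_span_pair.2 ⟨r, q, by linear_combination hr⟩,
    by ring⟩

end TwoGenerated

/-! ### Permuting regular sequences of forms. -/

section Permutation

open MvPolynomial Ideal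

variable {σ 𝕜 : Type*} [Field 𝕜]

attribute [local instance] MvPolynomial.gradedAlgebra in
theorem homogeneousComponent_mem_span {S : Set (MvPolynomial σ 𝕜)}
    (hS : ∀ f ∈ S, ∃ d : ℕ, f.IsHomogeneous d) {f : MvPolynomial σ 𝕜} (hf : f ∈ span S) (d : ℕ) :
    homogeneousComponent d f ∈ span S := by
  have h := Ideal.homogeneous_span (homogeneousSubmodule σ 𝕜) S
    (fun x hx => (hS x hx).imp fun d hd => hd)
  rw [← decomposition.decompose'_apply]
  exact h d hf

/-- A graded substitute for Krull's intersection theorem: g of order at least d + 1 does not affect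
the component of degree d. -/
theorem mem_span_of_forall_pow {S : Set (MvPolynomial σ 𝕜)}
    (hS : ∀ f ∈ S, ∃ d : ℕ, f.IsHomogeneous d) {f : MvPolynomial σ 𝕜}
    (hf : ∀ n, ∃ g ∈ idealOfVars σ 𝕜 ^ n, f - g ∈ span S) : f ∈ span S := by
  rw [← sum_homogeneousComponent f]
  refine sum_mem fun d _ => ?_
  obtain ⟨g, hg, hfg⟩ := hf (d + 1)
  have h := homogeneousComponent_mem_span hS hfg d
  have hg0 : homogeneousComponent d g = 0 := by
    ext x
    rw [coeff_homogeneousComponent, coeff_zero]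
    split_ifs with hx
    · exact (mem_pow_idealOfVars_iff' _ _).1 hg x (by omega)
    · rfl
  rwa [map_sub, hg0, sub_zero] at h

theorem mem_idealOfVars_iff {f : MvPolynomial σ 𝕜} :
    f ∈ idealOfVars σ 𝕜 ↔ constantCoeff f = 0 := by
  rw [← pow_one (idealOfVars σ 𝕜), mem_pow_idealOfVars_iff']
  constructor
  · intro h
    exact h 0 (by simp)
  · intro h x hx
    have : x = 0 := (Finsupp.degree_eq_zero_iff x).1 (by omega)
    rwa [this]

theorem idealOfVars_ne_top : idealOfVars σ 𝕜 ≠ ⊤ := by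
  rw [Ne, Ideal.eq_top_iff_one, mem_idealOfVars_iff]
  simp

open RingTheory.Sequence Submodule Pointwise in
/-- Weakly regular sequences of forms of positive degree may be permuted. -/
theorem isWeaklyRegular_perm {rs rs' : List (MvPolynomial σ 𝕜)}
    (h : IsWeaklyRegular (MvPolynomial σ 𝕜) rs) (hp : rs.Perm rs')
    (hhom : ∀ f ∈ rs, ∃ d : ℕ, f.IsHomogeneous d) (hpos : ∀ f ∈ rs, f ∈ idealOfVars σ 𝕜) :
    IsWeaklyRegular (MvPolynomial σ 𝕜) rs' := by
  refine h.prototype_perm hp ?_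
  intro a b ts hts K hK
  have hts' : ∀ f ∈ ({f | f ∈ ts} : Set _), ∃ d : ℕ, f.IsHomogeneous d := fun f hf =>
    hhom f (hts.subset (List.mem_cons_of_mem _ (List.mem_cons_of_mem _ hf)))
  have ha : a ∈ idealOfVars σ 𝕜 := hpos a (hts.subset List.mem_cons_self)
  -- Swapping neighbours reduces to showing that K = aK forces K = 0. Elements of K are divisible by
  -- every power of a, while the quotient by a homogeneous ideal is separated.
  have key : ∀ n, ∀ k ∈ K, ∃ k' ∈ K, a ^ n • k' = k := by
    intro n
    induction n with
    | zero => exact fun k hk => ⟨k, hk, by simp⟩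
    | succ n ih =>
      intro k hk
      obtain ⟨k', hk', rfl⟩ := ih k hk
      rw [hK] at hk'
      obtain ⟨k'', hk'', rfl⟩ := (Submodule.mem_smul_pointwise_iff_exists _ _ _).1 hk'
      exact ⟨k'', hk'', by rw [pow_succ, mul_smul]⟩
  rw [eq_bot_iff]
  intro k hk
  obtain ⟨z, rfl⟩ := Submodule.mkQ_surjective _ k
  rw [Submodule.mem_bot, Submodule.mkQ_apply, Submodule.Quotient.mk_eq_zero]
  have hJ : (Ideal.ofList ts • ⊤ : Submodule (MvPolynomial σ 𝕜) (MvPolynomial σ 𝕜)) =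
      span {f | f ∈ ts} := by
    rw [Ideal.smul_top_eq_map]; simp [Ideal.ofList]
  have hz : z ∈ Ideal.span {f | f ∈ ts} := by
    refine mem_span_of_forall_pow hts' fun n => ?_
    obtain ⟨k', _, hk'⟩ := key n _ hk
    obtain ⟨z', rfl⟩ := Submodule.mkQ_surjective _ k'
    refine ⟨a ^ n * z', Ideal.mul_mem_right _ _ (Ideal.pow_mem_pow ha n), ?_⟩
    rw [← map_smul, ← sub_eq_zero, ← map_sub, Submodule.mkQ_apply,
      Submodule.Quotient.mk_eq_zero, ← neg_mem_iff, neg_sub] at hk'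
    rw [hJ] at hk'
    exact hk'
  rw [hJ]
  exact hz

variable {n c s : ℕ} {F : Fin s → MvPolynomial (Fin (n + 1)) 𝕜}

/-- A form with nonzero constant term is a unit, but `F i` belongs to the proper ideal of some
regular sequence, as c + 1 ≤ s. -/
theorem IsStarConfiguration.mem_idealOfVars (hF : IsStarConfiguration n c s F) (hs : n + 1 ≤ s)
    (i : Fin s) : F i ∈ idealOfVars (Fin (n + 1)) 𝕜 := by
  have hc := hF.c_le
  obtain ⟨A, hA, hAc⟩ := Finset.exists_superset_card_eq (s := {i}) (n := c + 1)
    (by simp) (by simp; omega)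
  have hreg := hF.isRegular A hAc
  have hmem : F i ∈ Ideal.ofList ((A.sort (· ≤ ·)).map F) :=
    subset_span (List.mem_map.2 ⟨i, by simpa using hA, rfl⟩)
  have hne : Ideal.ofList ((A.sort (· ≤ ·)).map F) ≠ ⊤ := fun h => hreg.top_ne_smul (by
    rw [h]; simp)
  rw [mem_idealOfVars_iff]
  by_contra h0
  obtain ⟨d, hd⟩ := hF.isHomogeneous i
  have hd0 : d = 0 := by
    have := hd (d := 0) (by simpa [constantCoeff_eq] using h0)
    simpa using this.symm
  subst hd0
  have hC : F i = C (constantCoeff (F i)) := by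
    have := totalDegree_eq_zero_iff_eq_C.1 (Nat.le_zero.1 hd.totalDegree_le)
    simpa [constantCoeff_eq] using this
  refine hne (Ideal.eq_top_of_isUnit_mem _ hmem ?_)
  rw [hC]
  exact (isUnit_iff_ne_zero.2 h0).map C

/-- Enlarge B ∪ {j} to c + 1 indices and permute so that B comes first and j next. -/
theorem IsStarConfiguration.isRegularMod (hF : IsStarConfiguration n c s F) (hs : n + 1 ≤ s)
    {B : Finset (Fin s)} (hB : B.card ≤ c) {j : Fin s} (hj : j ∉ B) :
    IsRegularMod (span (F '' (B : Set (Fin s)))) (F j) := by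
  have hc := hF.c_le
  obtain ⟨A, hA, hAc⟩ := Finset.exists_superset_card_eq (s := insert j B) (n := c + 1)
    (by rw [Finset.card_insert_of_notMem hj]; omega) (by simp; omega)
  have hreg := (hF.isRegular A hAc).toIsWeaklyRegular
  have hperm : ((A.sort (· ≤ ·)).map F).Perm
      (B.toList.map F ++ (F j :: ((A \ insert j B).toList.map F))) := by
    have h1 : (A.sort (· ≤ ·)).Perm (B.toList ++ (j :: (A \ insert j B).toList)) := by
      refine (List.perm_ext_iff_of_nodup (Finset.sort_nodup _ _) ?_).2 ?_
      · simp only [List.nodup_append, List.nodup_cons, Finset.nodup_toList, Finset.mem_toList,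
          List.mem_cons, true_and, and_true]
        refine ⟨by simp, ?_⟩
        rintro a ha b (rfl | hb) rfl
        · exact hj ha
        · simp [ha] at hb
      · intro a
        simp only [Finset.mem_sort, List.mem_append, Finset.mem_toList, List.mem_cons,
          Finset.mem_sdiff, Finset.mem_insert, not_or]
        constructor
        · intro ha; tauto
        · rintro (h | rfl | h)
          · exact hA (Finset.mem_insert_of_mem h)
          · exact hA (Finset.mem_insert_self _ _)
          · exact h.1
    simpa using h1.map F
  have h2 := isWeaklyRegular_perm hreg hperm
    (by simp only [List.mem_map]; rintro _ ⟨i, _, rfl⟩; exact hF.isHomogeneous i)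
    (by simp only [List.mem_map]; rintro _ ⟨i, _, rfl⟩; exact hF.mem_idealOfVars hs i)
  rw [RingTheory.Sequence.isWeaklyRegular_append_iff,
    RingTheory.Sequence.isWeaklyRegular_cons_iff, isSMulRegular_quotient_iff_mem_of_smul_mem] at h2
  have hJ : (Ideal.ofList (B.toList.map F) • ⊤ : Submodule (MvPolynomial (Fin (n + 1)) 𝕜) _) =
      span (F '' (B : Set (Fin s))) := by
    rw [Ideal.smul_top_eq_map, Ideal.ofList]
    simp [Set.image]
  rw [hJ] at h2
  exact h2.2.1

end Permutation

/-! ### Symbolic powers and defect one for general ideals. -/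

section Symbolic

variable {R : Type*} [CommRing R] {I : Ideal R} {m : ℕ}

theorem mem_symbolicPower_iff {f : R} :
    f ∈ symbolicPower I m ↔ ∀ P ∈ associatedPrimes R (R ⧸ I), ∃ t ∉ P, t * f ∈ I ^ m := by
  simp only [symbolicPower, Ideal.mem_iInf, Ideal.mem_comap]
  refine forall₂_congr fun P hP => ?_
  have : P.IsPrime := hP.isPrime
  rw [IsLocalization.algebraMap_mem_map_algebraMap_iff P.primeCompl]
  rfl

/-- Prime avoidance: the conductor (I^m : f) lies in no associated prime of R/I, hence not in their
union, the set of zero divisors modulo I. -/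
theorem exists_isRegularMod_of_mem_symbolicPower [IsNoetherianRing R] {f : R}
    (hf : f ∈ symbolicPower I m) : ∃ t, IsRegularMod I t ∧ t * f ∈ I ^ m := by
  rw [mem_symbolicPower_iff] at hf
  by_contra! h
  have hsub : ((I ^ m).colon {f} : Set R) ⊆ ⋃ P ∈ associatedPrimes R (R ⧸ I), (P : Set R) := by
    rw [biUnion_associatedPrimes_eq_compl_regular]
    intro t ht hreg
    refine h t ?_ (by simpa [Submodule.mem_colon_singleton] using ht)
    simpa [IsRegularMod] using (isSMulRegular_quotient_iff_mem_of_smul_mem I t).1 hreg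
  obtain ⟨P, hP, hle⟩ := (Ideal.subset_union_prime_finite (associatedPrimes.finite R (R ⧸ I))
    (f := id) 0 0 fun P hP _ _ => hP.isPrime).1 hsub
  obtain ⟨t, htP, ht⟩ := hf P hP
  exact htP (hle (by simpa [Submodule.mem_colon_singleton] using ht))

theorem sdefect_eq_one_iff :
    sdefect I m = 1 ↔ (∃ v ∈ symbolicPower I m, symbolicPower I m ≤ Ideal.span {v} ⊔ I ^ m) ∧
      ¬ symbolicPower I m ≤ I ^ m := by
  rw [sdefect, Submodule.spanFinrank_eq_one_iff]
  refine and_congr ⟨?_, ?_⟩ (not_congr ⟨?_, ?_⟩)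
  · rintro ⟨w, hw⟩
    obtain ⟨⟨v, hv⟩, rfl⟩ := Submodule.mkQ_surjective _ w
    refine ⟨v, hv, fun f hf => ?_⟩
    have hmem := hw ▸ (Submodule.mem_top (x := Submodule.mkQ _ (⟨f, hf⟩ : symbolicPower I m)))
    obtain ⟨a, ha⟩ := Submodule.mem_span_singleton.1 hmem
    rw [← map_smul, ← sub_eq_zero, ← map_sub, Submodule.mkQ_apply,
      Submodule.Quotient.mk_eq_zero, ← neg_mem_iff, neg_sub, Submodule.submoduleOf,
      Submodule.mem_comap] at ha
    refine Submodule.mem_sup.2 ⟨a * v, Ideal.mem_span_singleton'.2 ⟨a, rfl⟩, f - a * v, ?_, by ring⟩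
    simpa using ha
  · rintro ⟨v, hv, hle⟩
    refine ⟨Submodule.mkQ _ ⟨v, hv⟩, eq_comm.1 (eq_top_iff.2 fun w _ => ?_)⟩
    obtain ⟨⟨f, hf⟩, rfl⟩ := Submodule.mkQ_surjective _ w
    obtain ⟨_, hx, y, hy, hxy⟩ := Submodule.mem_sup.1 (hle hf)
    obtain ⟨a, rfl⟩ := Ideal.mem_span_singleton'.1 hx
    refine Submodule.mem_span_singleton.2 ⟨a, ?_⟩
    rw [← map_smul, ← sub_eq_zero, ← map_sub, Submodule.mkQ_apply,
      Submodule.Quotient.mk_eq_zero, ← neg_mem_iff, neg_sub, Submodule.submoduleOf,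
      Submodule.mem_comap]
    have : f - a * v = y := by rw [← hxy]; ring
    simpa [this] using hy
  · intro h f hf
    have hmem := h ▸ (Submodule.mem_top (x := Submodule.mkQ _ (⟨f, hf⟩ : symbolicPower I m)))
    rw [Submodule.mem_bot, Submodule.mkQ_apply, Submodule.Quotient.mk_eq_zero,
      Submodule.submoduleOf, Submodule.mem_comap] at hmem
    simpa using hmem
  · intro h
    rw [eq_bot_iff]
    intro w _
    obtain ⟨⟨f, hf⟩, rfl⟩ := Submodule.mkQ_surjective _ w
    rw [Submodule.mem_bot, Submodule.mkQ_apply, Submodule.Quotient.mk_eq_zero,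
      Submodule.submoduleOf, Submodule.mem_comap]
    simpa using h hf

end Symbolic

/-! ### Intersections of squares of pair ideals, and principal ideals. -/

section SquarePairs

variable {R : Type*} [CommRing R]

open Ideal

/-- An element lying in `(F i, F j)^2` for all pairs of indices is a combination of the product of
all `F i` and of the squares of the products omitting one factor. -/
theorem mul_mem_of_forall_mem_span_pair_sq {ι : Type*} [DecidableEq ι] {F : ι → R} {T : Finset ι}
    (h1 : ∀ j ∈ T, IsRegularMod ⊥ (F j))
    (h2 : ∀ j ∈ T, ∀ k ∈ T, j ≠ k → IsRegularMod (span {F k}) (F j))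
    (h3 : ∀ i ∈ T, ∀ j ∈ T, ∀ k ∈ T, i ≠ j → i ≠ k → j ≠ k → IsRegularMod (span {F i, F j}) (F k))
    {f : R} (hf : ∀ i ∈ T, ∀ j ∈ T, i ≠ j → f ∈ span {F i, F j} ^ 2) {Q : Ideal R} {w : R}
    (hw : w * ∏ i ∈ T, F i ∈ Q) (hQ : ∀ i ∈ T, w * (∏ j ∈ T.erase i, F j) ^ 2 ∈ Q) :
    w * f ∈ Q := by
  induction T using Finset.induction_on generalizing w f with
  | empty =>
    rw [Finset.prod_empty, mul_one] at hw
    exact Ideal.mul_mem_right _ _ hw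
  | insert k T hk ih =>
    have hkT := Finset.mem_insert_self k T
    have hT : ∀ {j}, j ∈ T → j ∈ insert k T := fun hj => Finset.mem_insert_of_mem hj
    have hne : ∀ {j}, j ∈ T → k ≠ j := by rintro j hj rfl; exact hk hj
    have hfk : f ∈ span {F k, ∏ j ∈ T, F j} ^ (1 + 1) := mem_span_pair_prod_pow (h1 k hkT)
      (fun j hj => h2 j (hT hj) k hkT (hne hj).symm)
      (fun j hj l hl hjl => h3 k hkT l (hT hl) j (hT hj) (hne hl) (hne hj) hjl.symm)
      (fun j hj => hf k hkT j (hT hj) (hne hj))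
    obtain ⟨e, h, hh, rfl⟩ := mem_span_pair_pow_succ.1 hfk
    rw [pow_one] at hh
    obtain ⟨a, b, rfl⟩ := mem_span_pair.1 hh
    have hprod : ∏ i ∈ insert k T, F i = F k * ∏ i ∈ T, F i := Finset.prod_insert hk
    have he := hQ k hkT
    rw [Finset.erase_insert hk] at he
    rw [hprod] at hw
    -- Here f = e P^2 + F_k (a F_k + b P) with P the product over T, and only a F_k^2 is not yet
    -- handled. The weight w absorbs F_k^2, which is regular modulo each (F_i, F_j)^2, so induction
    -- applies to a.
    have ha : w * F k ^ 2 * a ∈ Q := by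
      refine ih (fun j hj => h1 j (hT hj)) (fun j hj l hl => h2 j (hT hj) l (hT hl))
        (fun i hi j hj l hl => h3 i (hT hi) j (hT hj) l (hT hl)) (fun i hi j hj hij => ?_) ?_
        (fun i hi => ?_)
      · have hreg := ((h1 i (hT hi)).span_pair_pow (h2 j (hT hj) i (hT hi) hij.symm)
          (h3 i (hT hi) j (hT hj) k hkT hij (hne hi).symm (hne hj).symm) 2).pow 2
        refine hreg _ ?_
        have hP : ∏ l ∈ T, F l ∈ span {F i, F j} ^ 2 := by
          rw [← Finset.mul_prod_erase T F hi,
            ← Finset.mul_prod_erase (T.erase i) F (Finset.mem_erase.2 ⟨hij.symm, hj⟩),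
            ← mul_assoc, sq]
          exact Ideal.mul_mem_right _ _
            (Ideal.mul_mem_mul (subset_span (by simp)) (subset_span (by simp)))
        have := sub_mem (hf i (hT hi) j (hT hj) hij)
          (Ideal.mul_mem_left _ (e * (∏ l ∈ T, F l) + F k * b) hP)
        convert this using 1
        ring
      · convert Ideal.mul_mem_left Q (F k) hw using 1
        ring
      · have := hQ i (hT hi)
        rw [Finset.erase_insert_of_ne (hne hi), Finset.prod_insert (by simp [hk])] at this
        convert this using 1
        ring
    have h3 := add_mem (add_mem (Ideal.mul_mem_left _ e he) ha) (Ideal.mul_mem_left _ b hw)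
    convert h3 using 1
    ring

theorem mem_span_prod_of_forall_mem {ι : Type*} [DecidableEq ι] {F : ι → R} {T : Finset ι}
    (h : ∀ j ∈ T, ∀ k ∈ T, j ≠ k → IsRegularMod (span {F k}) (F j)) {f : R}
    (hf : ∀ i ∈ T, f ∈ span {F i}) : f ∈ span {∏ i ∈ T, F i} := by
  induction T using Finset.induction_on with
  | empty => simp
  | insert k T hk ih =>
    have hT : ∀ {j}, j ∈ T → j ∈ insert k T := fun hj => Finset.mem_insert_of_mem hj
    obtain ⟨a, rfl⟩ := mem_span_singleton'.1 <|
      ih (fun j hj l hl => h j (hT hj) l (hT hl)) (fun i hi => hf i (hT hi))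
    have hreg : IsRegularMod (span {F k}) (∏ i ∈ T, F i) := IsRegularMod.prod T fun j hj =>
      h j (hT hj) k (Finset.mem_insert_self _ _) (by rintro rfl; exact hk hj)
    obtain ⟨b, rfl⟩ := mem_span_singleton'.1 <|
      hreg a (by rw [mul_comm]; exact hf k (Finset.mem_insert_self _ _))
    exact mem_span_singleton'.2 ⟨b, by rw [Finset.prod_insert hk]; ring⟩

theorem IsRegularMod.pow_of_span_singleton {x s : R} (hx : IsRegularMod ⊥ x)
    (hs : IsRegularMod (span {x}) s) (m : ℕ) : IsRegularMod (span {x} ^ m) s := by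
  induction m with
  | zero => intro z _; simp
  | succ m ih =>
    intro f hf
    obtain ⟨g, rfl⟩ := mem_span_singleton'.1 <|
      hs f (by simpa using Ideal.pow_le_pow_right (Nat.le_add_left 1 m) hf)
    rw [span_singleton_pow, mem_span_singleton'] at hf ⊢
    obtain ⟨b, hb⟩ := hf
    have h1 : s * g = b * x ^ m := hx.cancel (by linear_combination (-1 : R) * hb)
    have h2 := ih g (by rw [span_singleton_pow, h1]; exact mem_span_singleton'.2 ⟨b, rfl⟩)
    rw [span_singleton_pow, mem_span_singleton'] at h2
    obtain ⟨d, rfl⟩ := h2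
    exact ⟨d, by ring⟩

theorem IsRegularMod.map_mk {J K : Ideal R} {t : R} (h : IsRegularMod (K ⊔ J) t) :
    IsRegularMod (K.map (Ideal.Quotient.mk J)) (Ideal.Quotient.mk J t) := by
  intro z hz
  obtain ⟨z, rfl⟩ := Ideal.Quotient.mk_surjective z
  rw [← map_mul, Ideal.mem_quotient_iff_mem_sup] at hz
  rw [Ideal.mem_quotient_iff_mem_sup]
  exact h z hz

end SquarePairs

/-! ### Star ideals and their symbolic powers. -/

section Star

open Ideal

variable {R : Type*} [CommRing R] {s c m : ℕ} {F : Fin s → R}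

/-- Every `F j` is a nonzerodivisor modulo the ideal generated by at most `c` others. -/
def RegularUpTo (c : ℕ) (F : Fin s → R) : Prop :=
  ∀ B : Finset (Fin s), B.card ≤ c → ∀ j ∉ B, IsRegularMod (span (F '' (B : Set (Fin s)))) (F j)

theorem starIdeal_le {C : Finset (Fin s)} (hC : C.card = c) :
    starIdeal c F ≤ span (F '' (C : Set (Fin s))) := iInf₂_le C hC

theorem mem_starIdeal {f : R} :
    f ∈ starIdeal c F ↔ ∀ C : Finset (Fin s), C.card = c → f ∈ span (F '' (C : Set (Fin s))) := by
  simp [starIdeal]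

theorem mem_span_image {C : Finset (Fin s)} {j : Fin s} (hj : j ∈ C) :
    F j ∈ span (F '' (C : Set (Fin s))) := subset_span ⟨j, hj, rfl⟩

theorem prod_mem_of_mem {I : Ideal R} {T : Finset (Fin s)} {j : Fin s} (hj : j ∈ T)
    (h : F j ∈ I) : ∏ i ∈ T, F i ∈ I := by
  rw [← Finset.mul_prod_erase T F hj]
  exact Ideal.mul_mem_right _ _ h

theorem prod_mem_sq_of_mem {I : Ideal R} {T : Finset (Fin s)} {j k : Fin s} (hj : j ∈ T)
    (hk : k ∈ T) (hjk : j ≠ k) (h : F j ∈ I) (h' : F k ∈ I) : ∏ i ∈ T, F i ∈ I ^ 2 := by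
  rw [← Finset.mul_prod_erase T F hj, sq]
  exact Ideal.mul_mem_mul h (prod_mem_of_mem (Finset.mem_erase.2 ⟨hjk.symm, hk⟩) h')

theorem card_add_card_le_inter (T C : Finset (Fin s)) :
    T.card + C.card ≤ s + (T ∩ C).card := by
  rw [← Finset.card_union_add_card_inter]
  have : (T ∪ C).card ≤ s := by simpa using Finset.card_le_univ (T ∪ C)
  omega

theorem prod_mem_starIdeal {T : Finset (Fin s)} (hT : s < T.card + c) :
    ∏ i ∈ T, F i ∈ starIdeal c F := by
  refine mem_starIdeal.2 fun C hC => ?_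
  have := card_add_card_le_inter T C
  obtain ⟨j, hj⟩ : (T ∩ C).Nonempty := Finset.card_pos.1 (by omega)
  rw [Finset.mem_inter] at hj
  exact prod_mem_of_mem hj.1 (mem_span_image hj.2)

/-- Every other c-subset meets Cᶜ, so multiplying by the product over Cᶜ isolates the component of
C. -/
theorem prod_compl_mul_mem_starIdeal {C : Finset (Fin s)} (hC : C.card = c) {z : R}
    (hz : z ∈ span (F '' (C : Set (Fin s)))) : (∏ i ∈ Cᶜ, F i) * z ∈ starIdeal c F := by
  refine mem_starIdeal.2 fun C' hC' => ?_
  by_cases h : C' ⊆ C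
  · rw [Finset.eq_of_subset_of_card_le h (by omega)]
    exact Ideal.mul_mem_left _ _ hz
  · obtain ⟨j, hj, hj'⟩ := Finset.not_subset.1 h
    exact Ideal.mul_mem_right _ _ (prod_mem_of_mem (by simpa using hj') (mem_span_image hj))

theorem IsRegularMod.of_starIdeal (hN : RegularUpTo c F) {C : Finset (Fin s)} (hC : C.card = c)
    {t : R} (ht : IsRegularMod (starIdeal c F) t) :
    IsRegularMod (span (F '' (C : Set (Fin s)))) t := by
  intro z hz
  refine IsRegularMod.prod Cᶜ (fun j hj => hN C hC.le j (by simpa using hj)) z ?_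
  refine starIdeal_le hC (ht _ ?_)
  have := prod_compl_mul_mem_starIdeal hC hz
  rwa [mul_left_comm] at this

/-- An associated prime of the star ideal contains at most `c` of the `F j`. -/
theorem exists_notMem_of_mem_associatedPrimes [IsNoetherianRing R] (hN : RegularUpTo c F)
    {P : Ideal R} (hP : P ∈ associatedPrimes R (R ⧸ starIdeal c F)) :
    ∃ C : Finset (Fin s), C.card = c ∧ ∀ j ∉ C, F j ∉ P := by
  rw [AssociatedPrimes.mem_iff, isAssociatedPrime_iff] at hP
  obtain ⟨hPp, x, rfl⟩ := hP
  obtain ⟨x, rfl⟩ := Ideal.Quotient.mk_surjective x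
  have hcolon : ∀ r, r ∈ (⊥ : Submodule R (R ⧸ starIdeal c F)).colon
      {Ideal.Quotient.mk (starIdeal c F) x} ↔ r * x ∈ starIdeal c F := by
    intro r
    rw [Submodule.mem_colon_singleton, Submodule.mem_bot, ← Ideal.Quotient.eq_zero_iff_mem, map_mul]
    rfl
  have hx : x ∉ starIdeal c F := fun h =>
    hPp.ne_top ((Ideal.eq_top_iff_one _).2 ((hcolon 1).2 (by simpa using h)))
  rw [mem_starIdeal] at hx
  push Not at hx
  obtain ⟨C, hC, hxC⟩ := hx
  refine ⟨C, hC, fun j hj hjP => hxC ?_⟩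
  exact hN C hC.le j hj x (starIdeal_le hC ((hcolon _).1 hjP))

/-- At an associated prime P some C has all F_j with j ∉ C invertible, so the m-th power of their
product serves as denominator. -/
theorem mem_symbolicPower_starIdeal [IsNoetherianRing R] (hN : RegularUpTo c F) {f : R}
    (hf : ∀ C : Finset (Fin s), C.card = c → f ∈ span (F '' (C : Set (Fin s))) ^ m) :
    f ∈ symbolicPower (starIdeal c F) m := by
  refine mem_symbolicPower_iff.2 fun P hP => ?_
  obtain ⟨C, hC, hCP⟩ := exists_notMem_of_mem_associatedPrimes hN hP
  have hPp := hP.isPrime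
  refine ⟨(∏ i ∈ Cᶜ, F i) ^ m, fun h => ?_, ?_⟩
  · obtain ⟨j, hj, hjP⟩ := hPp.prod_mem_iff.1 (hPp.mem_of_pow_mem _ h)
    exact hCP j (by simpa using hj) hjP
  · have hle : span {∏ i ∈ Cᶜ, F i} * span (F '' (C : Set (Fin s))) ≤ starIdeal c F := by
      rw [Ideal.span_singleton_mul_le_iff]
      exact fun z hz => prod_compl_mul_mem_starIdeal hC hz
    refine Ideal.pow_right_mono hle m ?_
    rw [mul_pow]
    exact Ideal.mul_mem_mul (Ideal.pow_mem_pow (mem_span_singleton_self _) m) (hf C hC)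

/-- The factor t is kept because it is cancelled modulo m-th powers only for ideals with two
generators, directly or after passing to a quotient. -/
theorem exists_isRegularMod_span_of_mem_symbolicPower [IsNoetherianRing R]
    (hN : RegularUpTo c F) {f : R} (hf : f ∈ symbolicPower (starIdeal c F) m) :
    ∃ t, ∀ C : Finset (Fin s), C.card = c → IsRegularMod (span (F '' (C : Set (Fin s)))) t ∧
      t * f ∈ span (F '' (C : Set (Fin s))) ^ m := by
  obtain ⟨t, ht, htf⟩ := exists_isRegularMod_of_mem_symbolicPower hf
  exact ⟨t, fun C hC => ⟨ht.of_starIdeal hN hC, Ideal.pow_right_mono (starIdeal_le hC) m htf⟩⟩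

theorem symbolicPower_one_le [IsNoetherianRing R] (I : Ideal R) : symbolicPower I 1 ≤ I ^ 1 := by
  intro f hf
  obtain ⟨t, ht, htf⟩ := exists_isRegularMod_of_mem_symbolicPower hf
  rw [pow_one] at htf ⊢
  exact ht f htf

theorem RegularUpTo.isRegularMod_bot (hN : RegularUpTo c F) (j : Fin s) :
    IsRegularMod ⊥ (F j) := by
  simpa using hN ∅ (by simp) j (by simp)

theorem RegularUpTo.isRegularMod_singleton (hN : RegularUpTo c F) (hc : 1 ≤ c) {j k : Fin s}
    (hjk : j ≠ k) : IsRegularMod (span {F k}) (F j) := by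
  simpa using hN {k} (by simpa using hc) j (by simpa using hjk)

theorem RegularUpTo.isRegularMod_pair (hN : RegularUpTo c F) (hc : 2 ≤ c) {i j k : Fin s}
    (hi : k ≠ i) (hj : k ≠ j) : IsRegularMod (span {F i, F j}) (F k) := by
  simpa [Set.image_pair] using
    hN {i, j} (Finset.card_le_two.trans hc) k (by simp [hi, hj])

theorem symbolicPower_starIdeal_one_le [IsNoetherianRing R] (hN : RegularUpTo 1 F) :
    symbolicPower (starIdeal 1 F) m ≤ starIdeal 1 F ^ m := by
  intro f hf
  have hI : starIdeal 1 F = span {∏ i, F i} := by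
    refine le_antisymm (fun f hf => ?_) ((span_singleton_le_iff_mem _).2 ?_)
    · refine mem_span_prod_of_forall_mem
        (fun j _ k _ hjk => hN.isRegularMod_singleton le_rfl hjk) fun i _ => ?_
      simpa using mem_starIdeal.1 hf {i} (by simp)
    · exact prod_mem_starIdeal (by simp)
  obtain ⟨t, ht, htf⟩ := exists_isRegularMod_of_mem_symbolicPower hf
  rw [hI] at ht htf ⊢
  exact (IsRegularMod.prod _ fun j _ => hN.isRegularMod_bot j).pow_of_span_singleton ht m f htf

theorem symbolicPower_starIdeal_two_le [IsNoetherianRing R] (hN : RegularUpTo 2 F) :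
    symbolicPower (starIdeal 2 F) 2 ≤ span {∏ i, F i} ⊔ starIdeal 2 F ^ 2 := by
  intro f hf
  obtain ⟨t, ht⟩ := exists_isRegularMod_span_of_mem_symbolicPower hN hf
  rw [← one_mul f]
  refine mul_mem_of_forall_mem_span_pair_sq (T := Finset.univ)
    (fun j _ => hN.isRegularMod_bot j)
    (fun j _ k _ hjk => hN.isRegularMod_singleton one_le_two hjk)
    (fun i _ j _ k _ _ hik hjk => hN.isRegularMod_pair le_rfl hik.symm hjk.symm)
    (fun i _ j _ hij => ?_) ?_ (fun i _ => ?_)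
  · obtain ⟨h1, h2⟩ := ht {i, j} (Finset.card_pair hij)
    simp only [Finset.coe_pair, Set.image_pair] at h1 h2
    exact (hN.isRegularMod_bot i).span_pair_pow
      (hN.isRegularMod_singleton one_le_two hij.symm) h1 2 f h2
  · rw [one_mul]
    exact Submodule.mem_sup_left (mem_span_singleton_self _)
  · rw [one_mul]
    refine Submodule.mem_sup_right (Ideal.pow_mem_pow (prod_mem_starIdeal ?_) 2)
    have := i.pos
    rw [Finset.card_erase_of_mem (Finset.mem_univ i), Finset.card_univ, Fintype.card_fin]
    omega

end Star

/-! ### Distinguished elements and non-cyclicity. -/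

section Lower

open Ideal

variable {R : Type*} [CommRing R] {s c m : ℕ} {F : Fin s → R} {𝔪 : Ideal R}
  {A : Finset (Fin s)} {i : Fin s}

/-- The ideal generated by those members of the family whose index lies outside `A`. -/
def complIdeal (F : Fin s → R) (A : Finset (Fin s)) : Ideal R :=
  span (F '' ((Aᶜ : Finset (Fin s)) : Set (Fin s)))

/-- The product of all `F j` with `j ∈ A`, where each factor except `F i` is taken to the power
`m - 1`. -/
def distinguished (F : Fin s → R) (A : Finset (Fin s)) (i : Fin s) (m : ℕ) : R :=
  F i * (∏ j ∈ A.erase i, F j) ^ (m - 1)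

/-- An ideal containing `𝔪 I^(m) + I^m`, for the star ideal `I`, but no multiple of
`distinguished F A i m` by an element outside `𝔪`. -/
def testIdeal (F : Fin s → R) (𝔪 : Ideal R) (A : Finset (Fin s)) (i : Fin s) (m : ℕ) : Ideal R :=
  (leadingIdeal (𝔪.map (Ideal.Quotient.mk (complIdeal F A)))
    (Ideal.Quotient.mk (complIdeal F A) (F i))
    (Ideal.Quotient.mk (complIdeal F A) (∏ j ∈ A.erase i, F j)) m).comap
    (Ideal.Quotient.mk (complIdeal F A))

theorem map_span_image_sup (B : Finset (Fin s)) :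
    span (F '' (B : Set (Fin s))) ⊔ complIdeal F A =
      span (F '' ((B ∪ Aᶜ : Finset (Fin s)) : Set (Fin s))) := by
  rw [complIdeal, ← Ideal.span_union, ← Set.image_union, Finset.coe_union]

/-- A omits exactly c - 2 indices, which leaves room for two more generators. -/
theorem RegularUpTo.isRegularMod_mk (hN : RegularUpTo c F) (hA : A.card + c = s + 2)
    {B : Finset (Fin s)} (hB : B.card ≤ 2) {j : Fin s} (hj : j ∈ A) (hjB : j ∉ B) :
    IsRegularMod ((span (F '' (B : Set (Fin s)))).map (Ideal.Quotient.mk (complIdeal F A)))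
      (Ideal.Quotient.mk (complIdeal F A) (F j)) := by
  refine IsRegularMod.map_mk ?_
  rw [map_span_image_sup]
  refine hN _ ?_ j (by simp [hj, hjB])
  have h1 := Finset.card_union_le B Aᶜ
  have h2 := Finset.card_compl_add_card A
  rw [Fintype.card_fin] at h2
  omega

theorem RegularUpTo.mk_bot (hN : RegularUpTo c F) (hA : A.card + c = s + 2)
    {j : Fin s} (hj : j ∈ A) :
    IsRegularMod ⊥ (Ideal.Quotient.mk (complIdeal F A) (F j)) := by
  simpa using hN.isRegularMod_mk hA (B := ∅) (by simp) hj (by simp)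

theorem RegularUpTo.mk_singleton (hN : RegularUpTo c F) (hA : A.card + c = s + 2)
    {j k : Fin s} (hj : j ∈ A) (hjk : j ≠ k) :
    IsRegularMod (span {Ideal.Quotient.mk (complIdeal F A) (F k)})
      (Ideal.Quotient.mk (complIdeal F A) (F j)) := by
  simpa [Ideal.map_span] using
    hN.isRegularMod_mk hA (B := {k}) (by simp) hj (by simpa using hjk)

theorem RegularUpTo.mk_pair (hN : RegularUpTo c F) (hA : A.card + c = s + 2)
    {j k l : Fin s} (hj : j ∈ A) (hjk : j ≠ k) (hjl : j ≠ l) :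
    IsRegularMod (span {Ideal.Quotient.mk (complIdeal F A) (F k),
      Ideal.Quotient.mk (complIdeal F A) (F l)})
      (Ideal.Quotient.mk (complIdeal F A) (F j)) := by
  simpa [Ideal.map_span, Set.image_pair] using
    hN.isRegularMod_mk hA (B := {k, l}) Finset.card_le_two hj (by simp [hjk, hjl])

theorem RegularUpTo.mk_prod (hN : RegularUpTo c F) (hA : A.card + c = s + 2) :
    IsRegularMod (span {Ideal.Quotient.mk (complIdeal F A) (F i)})
      (Ideal.Quotient.mk (complIdeal F A) (∏ j ∈ A.erase i, F j)) := by
  rw [map_prod]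
  exact IsRegularMod.prod _ fun j hj =>
    hN.mk_singleton hA (Finset.mem_of_mem_erase hj) (Finset.ne_of_mem_erase hj)

theorem card_pair_union_compl (hA : A.card + c = s + 2) {j k : Fin s} (hj : j ∈ A) (hk : k ∈ A)
    (hjk : j ≠ k) : ({j, k} ∪ Aᶜ : Finset (Fin s)).card = c := by
  rw [Finset.card_union_of_disjoint, Finset.card_pair hjk]
  · have h2 := Finset.card_compl_add_card A
    rw [Fintype.card_fin] at h2
    omega
  · rw [Finset.disjoint_left]
    intro a ha ha'
    simp only [Finset.mem_insert, Finset.mem_singleton] at ha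
    rcases ha with rfl | rfl <;> simp_all

theorem map_span_pair_union_compl {j k : Fin s} :
    (span (F '' (({j, k} ∪ Aᶜ : Finset (Fin s)) : Set (Fin s)))).map
      (Ideal.Quotient.mk (complIdeal F A)) =
    span {Ideal.Quotient.mk (complIdeal F A) (F j), Ideal.Quotient.mk (complIdeal F A) (F k)} := by
  rw [← map_span_image_sup, Ideal.map_sup, Ideal.map_quotient_self, sup_bot_eq, Ideal.map_span]
  simp [Set.image_pair]

theorem mk_mem_span_pair_pow {f : R} {j k : Fin s}
    (hf : f ∈ span (F '' (({j, k} ∪ Aᶜ : Finset (Fin s)) : Set (Fin s))) ^ m) :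
    Ideal.Quotient.mk (complIdeal F A) f ∈ span {Ideal.Quotient.mk (complIdeal F A) (F j),
      Ideal.Quotient.mk (complIdeal F A) (F k)} ^ m := by
  rw [← map_span_pair_union_compl, ← Ideal.map_pow]
  exact Ideal.mem_map_of_mem _ hf

theorem mk_mem_span_pair_prod_pow (hN : RegularUpTo c F) (hA : A.card + c = s + 2) (hi : i ∈ A)
    {f : R} (hf : ∀ j ∈ A, i ≠ j → Ideal.Quotient.mk (complIdeal F A) f ∈
      span {Ideal.Quotient.mk (complIdeal F A) (F i),
        Ideal.Quotient.mk (complIdeal F A) (F j)} ^ m) :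
    Ideal.Quotient.mk (complIdeal F A) f ∈ span {Ideal.Quotient.mk (complIdeal F A) (F i),
        Ideal.Quotient.mk (complIdeal F A) (∏ j ∈ A.erase i, F j)} ^ m := by
  rw [map_prod]
  refine mem_span_pair_prod_pow (hN.mk_bot hA hi) (fun j hj => ?_) (fun j hj k hk hjk => ?_)
    fun j hj => ?_
  · exact hN.mk_singleton hA (Finset.mem_of_mem_erase hj) (Finset.ne_of_mem_erase hj)
  · exact hN.mk_pair hA (Finset.mem_of_mem_erase hj) (Finset.ne_of_mem_erase hj) hjk
  · exact hf j (Finset.mem_of_mem_erase hj) (Finset.ne_of_mem_erase hj).symm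

theorem mul_symbolicPower_le_testIdeal [IsNoetherianRing R] (hN : RegularUpTo c F)
    (hA : A.card + c = s + 2) (hi : i ∈ A) (hm : 2 ≤ m) :
    𝔪 * symbolicPower (starIdeal c F) m ≤ testIdeal F 𝔪 A i m := by
  rw [Ideal.mul_le]
  intro r hr f hf
  obtain ⟨t, ht⟩ := exists_isRegularMod_span_of_mem_symbolicPower hN hf
  obtain ⟨m, rfl⟩ := Nat.exists_eq_add_of_le' hm
  rw [testIdeal, Ideal.mem_comap, map_mul]
  refine mul_span_pair_pow_le_leadingIdeal (Ideal.mul_mem_mul (Ideal.mem_map_of_mem _ hr)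
    (mk_mem_span_pair_prod_pow hN hA hi fun j hj hij => ?_))
  obtain ⟨h1, h2⟩ := ht _ (card_pair_union_compl hA hi hj hij)
  have h3 := mk_mem_span_pair_pow h2
  rw [map_mul] at h3
  refine (hN.mk_bot hA hi).span_pair_pow (hN.mk_singleton hA hj hij.symm) ?_ _ _ h3
  rw [← map_span_pair_union_compl]
  refine IsRegularMod.map_mk ?_
  rw [map_span_image_sup, Finset.union_assoc, Finset.union_self]
  exact h1

/-- Write the image of an element of I as a x + b y. For two further indices j, k in A, both it and
y lie in (F_j, F_k), modulo which x is regular; so a ∈ (F_j, F_k), inside the image of `𝔪`. -/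
theorem pow_starIdeal_le_testIdeal (hN : RegularUpTo c F) (h𝔪 : ∀ j, F j ∈ 𝔪)
    (hA : A.card + c = s + 2) (hA3 : 3 ≤ A.card) (hi : i ∈ A) (hm : 1 ≤ m) :
    starIdeal c F ^ m ≤ testIdeal F 𝔪 A i m := by
  rw [testIdeal, ← Ideal.map_le_iff_le_comap, Ideal.map_pow]
  refine pow_le_leadingIdeal (fun f hf => ?_) hm
  obtain ⟨g, hg, rfl⟩ := (Ideal.mem_map_iff_of_surjective _ Ideal.Quotient.mk_surjective).1 hf
  have hpair : ∀ {j k}, j ∈ A → k ∈ A → j ≠ k → Ideal.Quotient.mk (complIdeal F A) g ∈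
      span {Ideal.Quotient.mk (complIdeal F A) (F j),
        Ideal.Quotient.mk (complIdeal F A) (F k)} ^ 1 := fun hj hk hjk =>
    mk_mem_span_pair_pow (by
      rw [pow_one]; exact starIdeal_le (card_pair_union_compl hA hj hk hjk) hg)
  have hprod := mk_mem_span_pair_prod_pow hN hA hi fun j hj hij => hpair hi hj hij
  rw [pow_one] at hprod
  obtain ⟨a, b, hab⟩ := mem_span_pair.1 hprod
  refine ⟨a, ?_, b, hab.symm⟩
  obtain ⟨j, hj, k, hk, hjk⟩ := Finset.one_lt_card.1
    (by rw [Finset.card_erase_of_mem hi]; omega : 1 < (A.erase i).card)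
  have hjA := Finset.mem_of_mem_erase hj
  have hkA := Finset.mem_of_mem_erase hk
  have h1 := hpair hjA hkA hjk
  rw [pow_one] at h1
  have h2 : Ideal.Quotient.mk (complIdeal F A) (∏ j ∈ A.erase i, F j) ∈
      span {Ideal.Quotient.mk (complIdeal F A) (F j),
        Ideal.Quotient.mk (complIdeal F A) (F k)} := by
    rw [← Finset.mul_prod_erase _ F hj, map_mul]
    exact Ideal.mul_mem_right _ _ (subset_span (by simp))
  have h3 : a ∈ span {Ideal.Quotient.mk (complIdeal F A) (F j),
      Ideal.Quotient.mk (complIdeal F A) (F k)} := by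
    refine hN.mk_pair hA hi (Finset.ne_of_mem_erase hj).symm (Finset.ne_of_mem_erase hk).symm a ?_
    have h4 := sub_mem h1 (Ideal.mul_mem_left _ b h2)
    rw [← hab] at h4
    convert h4 using 1
    ring
  refine (span_le.2 ?_ : _ ≤ _) h3
  rintro _ (rfl | rfl)
  · exact Ideal.mem_map_of_mem _ (h𝔪 _)
  · exact Ideal.mem_map_of_mem _ (h𝔪 _)

theorem mem_of_mul_distinguished_mem_testIdeal (hN : RegularUpTo c F) (h𝔪 : ∀ j, F j ∈ 𝔪)
    (hA : A.card + c = s + 2) (hA3 : 3 ≤ A.card) (hi : i ∈ A) (hm : 1 ≤ m) {α : R}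
    (h : α * distinguished F A i m ∈ testIdeal F 𝔪 A i m) : α ∈ 𝔪 := by
  rw [testIdeal, Ideal.mem_comap, distinguished, map_mul, map_mul, map_pow] at h
  have h1 := mem_sup_span_pair_of_mul_mem_leadingIdeal (hN.mk_bot hA hi) (hN.mk_prod hA) hm h
  have hle : span {Ideal.Quotient.mk (complIdeal F A) (F i),
      Ideal.Quotient.mk (complIdeal F A) (∏ j ∈ A.erase i, F j)} ≤
      𝔪.map (Ideal.Quotient.mk (complIdeal F A)) := by
    obtain ⟨j, hj⟩ := Finset.card_pos.1
      (by rw [Finset.card_erase_of_mem hi]; omega : 0 < (A.erase i).card)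
    rw [span_le]
    rintro _ (rfl | rfl)
    · exact Ideal.mem_map_of_mem _ (h𝔪 _)
    · exact Ideal.mem_map_of_mem _ (prod_mem_of_mem hj (h𝔪 _))
  have hJ : complIdeal F A ≤ 𝔪 := span_le.2 (by rintro _ ⟨j, _, rfl⟩; exact h𝔪 j)
  rw [sup_eq_left.2 hle, Ideal.mem_quotient_iff_mem_sup, sup_eq_left.2 hJ] at h1
  exact h1

/-- A meets every c-subset C in at least two indices. If i ∈ C, the orders are 1 and m - 1;
otherwise two factors of exponent m - 1 suffice, as 2(m - 1) ≥ m. -/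
theorem distinguished_mem_symbolicPower [IsNoetherianRing R] (hN : RegularUpTo c F)
    (hA : A.card + c = s + 2) (hi : i ∈ A) (hm : 2 ≤ m) :
    distinguished F A i m ∈ symbolicPower (starIdeal c F) m := by
  refine mem_symbolicPower_starIdeal hN fun C hC => ?_
  obtain ⟨m, rfl⟩ := Nat.exists_eq_add_of_le' hm
  have hcard := card_add_card_le_inter (A.erase i) C
  have hpos : 0 < A.card := Finset.card_pos.2 ⟨i, hi⟩
  rw [Finset.card_erase_of_mem hi] at hcard
  rw [distinguished, show m + 2 - 1 = m + 1 by omega]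
  by_cases hiC : i ∈ C
  · obtain ⟨j, hj⟩ := Finset.card_pos.1 (by omega : 0 < (A.erase i ∩ C).card)
    rw [Finset.mem_inter] at hj
    rw [pow_succ' _ (m + 1)]
    exact Ideal.mul_mem_mul (mem_span_image hiC)
      (Ideal.pow_mem_pow (prod_mem_of_mem hj.1 (mem_span_image hj.2)) _)
  · have h1 := card_add_card_le_inter A C
    have h2 : A ∩ C = A.erase i ∩ C := by
      ext a
      simp only [Finset.mem_inter, Finset.mem_erase]
      exact ⟨fun h => ⟨⟨by rintro rfl; exact hiC h.2, h.1⟩, h.2⟩, fun h => ⟨h.1.2, h.2⟩⟩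
    rw [h2] at h1
    obtain ⟨j, hj, k, hk, hjk⟩ := Finset.one_lt_card.1
      (by omega : 1 < (A.erase i ∩ C).card)
    rw [Finset.mem_inter] at hj hk
    refine Ideal.mul_mem_left _ _ (Ideal.pow_le_pow_right (by omega : m + 2 ≤ 2 * (m + 1)) ?_)
    rw [pow_mul]
    exact Ideal.pow_mem_pow (prod_mem_sq_of_mem hj.1 hk.1 hjk (mem_span_image hj.2)
      (mem_span_image hk.2)) _

/-- F_i occurs with exponent m - 1 ≥ 2, so the element falls into the x^2 part. -/
theorem distinguished_mem_testIdeal_of_ne {i' : Fin s} (hi : i ∈ A) (hii' : i ≠ i') (hm : 3 ≤ m) :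
    distinguished F A i' m ∈ testIdeal F 𝔪 A i m := by
  obtain ⟨m, rfl⟩ := Nat.exists_eq_add_of_le' hm
  obtain ⟨r, hr⟩ : F i ∣ ∏ j ∈ A.erase i', F j :=
    Finset.dvd_prod_of_mem F (Finset.mem_erase.2 ⟨hii', hi⟩)
  rw [testIdeal, Ideal.mem_comap]
  refine mem_leadingIdeal.2 ⟨0, 0, zero_mem _, Ideal.Quotient.mk _
    (F i' * F i ^ m * r ^ (m + 2)), ?_⟩
  rw [distinguished, hr, ← map_pow _ (F i), ← map_mul, show m + 3 - 1 = m + 2 by omega]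
  simp only [zero_mul, mul_zero, zero_add]
  congr 1
  ring

theorem distinguished_mem_testIdeal_of_notMem {A' : Finset (Fin s)} {i' j : Fin s} (hi' : i' ∈ A')
    (hj : j ∈ A') (hjA : j ∉ A) : distinguished F A' i' 2 ∈ testIdeal F 𝔪 A i m := by
  have h : distinguished F A' i' 2 ∈ complIdeal F A := by
    rw [distinguished, show 2 - 1 = 1 from rfl, pow_one, Finset.mul_prod_erase A' F hi']
    exact prod_mem_of_mem hj (mem_span_image (by simpa using hjA))
  rw [testIdeal, Ideal.mem_comap, Ideal.Quotient.eq_zero_iff_mem.2 h]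
  exact zero_mem _

/-- Two distinguished elements that are independent modulo `𝔪 I^(m) + I^m` prevent `I^(m) / I^m`
from being cyclic. -/
theorem not_symbolicPower_le_span_sup_pow [IsNoetherianRing R] (hN : RegularUpTo c F)
    (h𝔪 : ∀ j, F j ∈ 𝔪) (h𝔪1 : 𝔪 ≠ ⊤) (hA : A.card + c = s + 2) (hA3 : 3 ≤ A.card) (hi : i ∈ A)
    {A' : Finset (Fin s)} {i' : Fin s} (hA' : A'.card + c = s + 2) (hi' : i' ∈ A') (hm : 2 ≤ m)
    (hind : distinguished F A' i' m ∈ testIdeal F 𝔪 A i m) :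
    ¬ ∃ v ∈ symbolicPower (starIdeal c F) m,
      symbolicPower (starIdeal c F) m ≤ span {v} ⊔ starIdeal c F ^ m := by
  rintro ⟨v, hv, hle⟩
  obtain ⟨_, hx, w, hw, h⟩ := Submodule.mem_sup.1
    (hle (distinguished_mem_symbolicPower hN hA hi hm))
  obtain ⟨r, rfl⟩ := Ideal.mem_span_singleton'.1 hx
  obtain ⟨_, hx', w', hw', h'⟩ := Submodule.mem_sup.1
    (hle (distinguished_mem_symbolicPower hN hA' hi' hm))
  obtain ⟨r', rfl⟩ := Ideal.mem_span_singleton'.1 hx'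
  have hpow := pow_starIdeal_le_testIdeal hN h𝔪 hA hA3 hi (by omega : 1 ≤ m)
  -- Eliminating v places r' times the first distinguished element in the test ideal. Then the
  -- second one lies in 𝔪 I^(m) + I^m, which its own test ideal excludes.
  have hr' : r' ∈ 𝔪 := by
    refine mem_of_mul_distinguished_mem_testIdeal hN h𝔪 hA hA3 hi (by omega : 1 ≤ m) ?_
    have h1 := add_mem (Ideal.mul_mem_left _ r hind)
      (hpow (sub_mem (Ideal.mul_mem_left _ r' hw) (Ideal.mul_mem_left _ r hw')))
    convert h1 using 1
    rw [← h, ← h']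
    ring
  have hA'3 : 3 ≤ A'.card := by omega
  refine h𝔪1 ((Ideal.eq_top_iff_one _).2 ?_)
  refine mem_of_mul_distinguished_mem_testIdeal hN h𝔪 hA' hA'3 hi' (by omega : 1 ≤ m) ?_
  rw [one_mul, ← h']
  exact add_mem (mul_symbolicPower_le_testIdeal hN hA' hi' hm (Ideal.mul_mem_mul hr' hv))
    (pow_starIdeal_le_testIdeal hN h𝔪 hA' hA'3 hi' (by omega : 1 ≤ m) hw')

theorem sdefect_starIdeal_ne_one [IsNoetherianRing R] (hN : RegularUpTo c F)
    (h𝔪 : ∀ j, F j ∈ 𝔪) (h𝔪1 : 𝔪 ≠ ⊤) (hcs : c + 1 ≤ s) (hc : 2 ≤ c) (hm : 2 ≤ m)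
    (hcm : ¬ (c = 2 ∧ m = 2)) : sdefect (starIdeal c F) m ≠ 1 := by
  rw [Ne, sdefect_eq_one_iff]
  refine fun h => absurd h.1 ?_
  obtain ⟨A, -, hA⟩ := Finset.exists_subset_card_eq (s := (Finset.univ : Finset (Fin s)))
    (n := s + 2 - c) (by simp; omega)
  obtain ⟨i, hi, i', hi', hii'⟩ := Finset.one_lt_card.1 (by omega : 1 < A.card)
  obtain hm3 | rfl : 3 ≤ m ∨ m = 2 := by omega
  · exact not_symbolicPower_le_span_sup_pow hN h𝔪 h𝔪1 (by omega) (by omega) hi (by omega) hi' hm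
      (distinguished_mem_testIdeal_of_ne hi hii' hm3)
  -- Here c ≥ 3, so A is a proper subset, and exchanging i for an outside index j gives the second
  -- set.
  · obtain ⟨j, hj⟩ : ∃ j, j ∉ A := by
      by_contra! h
      have := Finset.card_eq_iff_eq_univ A |>.2 (Finset.eq_univ_iff_forall.2 h)
      rw [Fintype.card_fin] at this
      omega
    have hj' : j ∉ A.erase i := fun h => hj (Finset.mem_of_mem_erase h)
    have hcard : (insert j (A.erase i)).card = A.card := by
      rw [Finset.card_insert_of_notMem hj', Finset.card_erase_of_mem hi]
      omega
    exact not_symbolicPower_le_span_sup_pow hN h𝔪 h𝔪1 (A' := insert j (A.erase i)) (i' := j)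
      (by omega) (by omega) hi (by omega) (Finset.mem_insert_self _ _) hm
      (distinguished_mem_testIdeal_of_notMem (Finset.mem_insert_self _ _)
        (Finset.mem_insert_self _ _) hj)

theorem sdefect_starIdeal_two [IsNoetherianRing R] (hN : RegularUpTo 2 F)
    (h𝔪 : ∀ j, F j ∈ 𝔪) (h𝔪1 : 𝔪 ≠ ⊤) (hs : 3 ≤ s) : sdefect (starIdeal 2 F) 2 = 1 := by
  let i : Fin s := ⟨0, by omega⟩
  have hi : i ∈ (Finset.univ : Finset (Fin s)) := Finset.mem_univ i
  have hA : (Finset.univ : Finset (Fin s)).card + 2 = s + 2 := by simp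
  have hA3 : 3 ≤ (Finset.univ : Finset (Fin s)).card := by simpa using hs
  have hmem := distinguished_mem_symbolicPower hN hA hi le_rfl
  rw [sdefect_eq_one_iff]
  refine ⟨⟨_, hmem, ?_⟩, fun hle => h𝔪1 ((Ideal.eq_top_iff_one _).2 ?_)⟩
  · rw [distinguished, show 2 - 1 = 1 from rfl, pow_one, Finset.mul_prod_erase _ F hi]
    exact symbolicPower_starIdeal_two_le hN
  · refine mem_of_mul_distinguished_mem_testIdeal hN h𝔪 hA hA3 hi one_le_two ?_
    rw [one_mul]
    exact pow_starIdeal_le_testIdeal hN h𝔪 hA hA3 hi one_le_two (hle hmem)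

end Lower

end StarConfig

theorem theorem3p12 {𝕜 : Type*} [Field 𝕜] (n c s m : ℕ)
    (F : Fin s → MvPolynomial (Fin (n + 1)) 𝕜)
    (hF : StarConfig.IsStarConfiguration n c s F) (hs : n + 1 ≤ s) (hm : 1 ≤ m) :
    StarConfig.sdefect (StarConfig.starIdeal c F) m = 1 ↔ c = 2 ∧ m = 2 := by
  have hN : StarConfig.RegularUpTo c F := fun B hB j hj => hF.isRegularMod hs hB hj
  have h𝔪 := hF.mem_idealOfVars hs
  have h𝔪1 := StarConfig.idealOfVars_ne_top (σ := Fin (n + 1)) (𝕜 := 𝕜)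
  have hc := hF.c_le
  have hc1 := hF.one_le_c
  constructor
  · intro h
    by_contra hcm
    rcases Nat.lt_or_ge c 2 with hc2 | hc2
    · obtain rfl : c = 1 := by omega
      exact (StarConfig.sdefect_eq_one_iff.1 h).2 (StarConfig.symbolicPower_starIdeal_one_le hN)
    rcases Nat.lt_or_ge m 2 with hm2 | hm2
    · obtain rfl : m = 1 := by omega
      exact (StarConfig.sdefect_eq_one_iff.1 h).2 (StarConfig.symbolicPower_one_le _)
    exact StarConfig.sdefect_starIdeal_ne_one hN h𝔪 h𝔪1 (by omega) hc2 hm2 hcm h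
  · rintro ⟨rfl, rfl⟩
    exact StarConfig.sdefect_starIdeal_two hN h𝔪 h𝔪1 (by omega)
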